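/- Let $M$ be a smooth $n$-dimensional manifold, $D\subset TM\setminus 0$ an open set closed under multiplication by positive scalars, and let $F^n=(M,L)$ be a Finsler space on $D$: $L>0$ is smooth on $D$, positively homogeneous of degree one in $y$, and $g_{ij}=\tfrac12\dot\partial_i\dot\partial_jL^2$ is nonsingular, where $\partial_i=\partial/\partial x^i$ and $\dot\partial_i=\partial/\partial y^i$. Let $l_i=\dot\partial_iL$, $h_{ij}=g_{ij}-l_il_j$, $C_{ijk}=\tfrac12\dot\partial_kg_{ij}$, $C^h_{ij}=g^{hr}C_{ijr}$. The Cartan connection of $F^n$ has the coefficients $$F^i_{jk}=\tfrac12g^{ir}(\delta_jg_{rk}+\delta_kg_{rj}-\delta_rg_{jk}),\qquad \delta_j=\partial_j-N^r_j\dot\partial_r,\qquad N^i_j=\gamma^i_{jk}y^k-C^i_{jr}\gamma^r_{kl}y^ky^l,$$ where $\gamma^i_{jk}=\tfrac12g^{ir}(\partial_jg_{rk}+\partial_kg_{rj}-\partial_rg_{jk})$. Let $b_i(x,y)$ be a smooth h-vector of $F^n$ on $D$, that is, a covector field depending on position and direction that is v-covariantly constant, $$b_i|_k:=\dot\partial_kb_i-b_rC^r_{ik}=0,$$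 and satisfies $L\,C^h_{ij}b_h=\rho\,h_{ij}$ for a nowhere vanishing scalar function $\rho$ on $D$; if $n=2$, assume moreover that $\rho$ depends on $x$ only. Suppose that the Kropina change ${}^*L=L^2/(b_iy^i)$ makes ${}^*F^n=(M,{}^*L)$ a Finsler space on $D$ as well. Then the Cartan connection coefficients of $F^n$ and ${}^*F^n$ coincide on $D$ in every coordinate system, ${}^*F^i_{jk}=F^i_{jk}$, if and only if $b_i$ is parallel with respect to the Cartan connection of $F^n$, that is, $b_{i|j}:=\delta_jb_i-b_rF^r_{ij}=0$ on $D$. -/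

import Mathlib

open scoped Manifold ContDiff

noncomputable section

namespace Finsler

/-- The model space `ℝⁿ`. -/
abbrev E (n : ℕ) : Type := EuclideanSpace ℝ (Fin n)

/-- The `i`-th coordinate vector of `ℝⁿ`. -/
def basisVec {n : ℕ} (i : Fin n) : E n := EuclideanSpace.single i 1

/-! ### Local tensor calculus

Points of a coordinate neighbourhood of the tangent bundle are pairs `z = (x, y)`, where `x` is
the position and `y` the direction. Below, `L` is a function of `(x, y)`. -/

section Local

variable {n : ℕ}

/-- `∂_j f`, the partial derivative with respect to `x^j`. -/
def dx (j : Fin n) (f : E n × E n → ℝ) (z : E n × E n) : ℝ := fderiv ℝ f z (basisVec j, 0)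

/-- `∂̇_j f`, the partial derivative with respect to `y^j`. -/
def dy (j : Fin n) (f : E n × E n → ℝ) (z : E n × E n) : ℝ := fderiv ℝ f z (0, basisVec j)

/-- The fundamental tensor `g_ij = ½ ∂̇_i ∂̇_j L²`. -/
def metric (L : E n × E n → ℝ) (i j : Fin n) (z : E n × E n) : ℝ :=
  (1 / 2) * dy i (dy j (fun w => L w ^ 2)) z

/-- The matrix of the fundamental tensor. -/
def metricMatrix (L : E n × E n → ℝ) (z : E n × E n) : Matrix (Fin n) (Fin n) ℝ :=
  Matrix.of fun i j => metric L i j z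

/-- The inverse tensor `g^{ij}`. -/
def metricInv (L : E n × E n → ℝ) (i j : Fin n) (z : E n × E n) : ℝ :=
  (metricMatrix L z)⁻¹ i j

/-- The angular metric tensor `h_ij = g_ij - l_i l_j`, where `l_i = ∂̇_i L`. -/
def angular (L : E n × E n → ℝ) (i j : Fin n) (z : E n × E n) : ℝ :=
  metric L i j z - dy i L z * dy j L z

/-- The Cartan tensor `C_ijk = ½ ∂̇_k g_ij`. -/
def cartanLower (L : E n × E n → ℝ) (i j k : Fin n) (z : E n × E n) : ℝ :=
  (1 / 2) * dy k (metric L i j) z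

/-- `C^h_ij = g^{hr} C_ijr`. -/
def cartanC (L : E n × E n → ℝ) (h i j : Fin n) (z : E n × E n) : ℝ :=
  ∑ r, metricInv L h r z * cartanLower L i j r z

/-- The formal Christoffel symbols
`γ^i_jk = ½ g^{ir} (∂_j g_rk + ∂_k g_rj - ∂_r g_jk)`. -/
def christoffel (L : E n × E n → ℝ) (i j k : Fin n) (z : E n × E n) : ℝ :=
  ∑ r, (1 / 2) * metricInv L i r z *
    (dx j (metric L r k) z + dx k (metric L r j) z - dx r (metric L j k) z)

/-- `γ^i_00 = γ^i_jk y^j y^k`; this is `2 G^i`, the geodesic spray coefficients. -/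
def spray (L : E n × E n → ℝ) (i : Fin n) (z : E n × E n) : ℝ :=
  ∑ j, ∑ k, christoffel L i j k z * z.2 j * z.2 k

/-- The Cartan nonlinear connection `N^i_j = γ^i_jk y^k - C^i_jr γ^r_00`
(it equals `∂̇_j G^i` with `G^i = ½ γ^i_00`). -/
def nonlin (L : E n × E n → ℝ) (i j : Fin n) (z : E n × E n) : ℝ :=
  ∑ k, christoffel L i j k z * z.2 k - ∑ r, cartanC L i j r z * spray L r z

/-- The horizontal derivative `δ_j f = ∂_j f - N^r_j ∂̇_r f` defined by `L`. -/
def delta (L : E n × E n → ℝ) (j : Fin n) (f : E n × E n → ℝ) (z : E n × E n) : ℝ :=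
  dx j f z - ∑ r, nonlin L r j z * dy r f z

/-- The (horizontal) Cartan connection coefficients
`F^i_jk = ½ g^{ir} (δ_j g_rk + δ_k g_rj - δ_r g_jk)`. -/
def cartanF (L : E n × E n → ℝ) (i j k : Fin n) (z : E n × E n) : ℝ :=
  ∑ r, (1 / 2) * metricInv L i r z *
    (delta L j (metric L r k) z + delta L k (metric L r j) z - delta L r (metric L j k) z)

/-- The h-covariant derivative `b_{i|j} = δ_j b_i - b_r F^r_ij` of a covector field `b_i(x, y)`. -/
def hCov (L : E n × E n → ℝ) (b : Fin n → E n × E n → ℝ) (i j : Fin n) (z : E n × E n) : ℝ :=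
  delta L j (b i) z - ∑ r, b r z * cartanF L r i j z

/-- The v-covariant derivative `b_i|_k = ∂̇_k b_i - b_r C^r_ik` of a covector field `b_i(x, y)`. -/
def vCov (L : E n × E n → ℝ) (b : Fin n → E n × E n → ℝ) (i k : Fin n) (z : E n × E n) : ℝ :=
  dy k (b i) z - ∑ r, b r z * cartanC L r i k z

end Local

/-! ### Objects on a manifold and their coordinate expressions -/

section Global

variable {n : ℕ} {M : Type*} [TopologicalSpace M] [ChartedSpace (E n) M]

/-- The coordinate frame: the vector `y^i ∂/∂x^i` at the point with coordinates `x`. -/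
def frame (φ : OpenPartialHomeomorph M (E n)) (x y : E n) : TangentSpace (𝓡 n) (φ.symm x) :=
  mfderiv (𝓡 n) (𝓡 n) φ.symm x y

/-- The element of the tangent bundle with coordinates `z = (x, y)` in the chart `φ`. -/
def ofCoord (φ : OpenPartialHomeomorph M (E n)) (z : E n × E n) : TangentBundle (𝓡 n) M :=
  ⟨φ.symm z.1, frame φ z.1 z.2⟩

/-- The set of coordinates `(x, y)` of those elements of `D` that lie over the chart `φ`. -/
def coordDomain (φ : OpenPartialHomeomorph M (E n)) (D : Set (TangentBundle (𝓡 n) M)) :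
    Set (E n × E n) :=
  {z | z.1 ∈ φ.target ∧ ofCoord φ z ∈ D}

/-- The coordinate expression `f(x, y)` of a function on the tangent bundle. -/
def coordFun (φ : OpenPartialHomeomorph M (E n)) (f : TangentBundle (𝓡 n) M → ℝ) :
    E n × E n → ℝ :=
  fun z => f (ofCoord φ z)

/-- The components `b_i(x, y)` of a covector field `b` that depends on position and direction:
`b u` is a covector at the base point of `u`. -/
def coordCovec (φ : OpenPartialHomeomorph M (E n))
    (b : (u : TangentBundle (𝓡 n) M) → TangentSpace (𝓡 n) u.proj →L[ℝ] ℝ) (i : Fin n) :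
    E n × E n → ℝ :=
  fun z => b (ofCoord φ z) (frame φ z.1 (basisVec i))

/-- `(M, L)` is a Finsler space with fundamental function `L` on the open cone bundle `D` of
nonzero tangent vectors: `L` is positive, smooth, positively homogeneous of degree one in the
direction, and its fundamental tensor is nonsingular. (Kropina metrics are only defined on such
a domain, where `b_i y^i` does not vanish.) -/
structure IsFinslerSpace [IsManifold (𝓡 n) ∞ M] (D : Set (TangentBundle (𝓡 n) M))
    (L : TangentBundle (𝓡 n) M → ℝ) : Prop where
  isOpen : IsOpen D
  ne_zero : ∀ u ∈ D, u.2 ≠ 0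
  cone : ∀ u ∈ D, ∀ t : ℝ, 0 < t → (⟨u.proj, t • u.2⟩ : TangentBundle (𝓡 n) M) ∈ D
  pos : ∀ u ∈ D, 0 < L u
  homogeneous : ∀ u ∈ D, ∀ t : ℝ, 0 < t → L ⟨u.proj, t • u.2⟩ = t * L u
  smooth : ∀ φ ∈ IsManifold.maximalAtlas (𝓡 n) ∞ M,
    ContDiffOn ℝ ∞ (coordFun φ L) (coordDomain φ D)
  nonsingular : ∀ φ ∈ IsManifold.maximalAtlas (𝓡 n) ∞ M, ∀ z ∈ coordDomain φ D,
    (metricMatrix (coordFun φ L) z).det ≠ 0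

/-- `b` is an h-vector of `(M, L)` with nonzero scalar function `ρ`: it is smooth, v-covariantly
constant, `b_i|_k = 0`, and satisfies `L C^h_ij b_h = ρ h_ij`. -/
structure IsHVector (D : Set (TangentBundle (𝓡 n) M)) (L : TangentBundle (𝓡 n) M → ℝ)
    (b : (u : TangentBundle (𝓡 n) M) → TangentSpace (𝓡 n) u.proj →L[ℝ] ℝ)
    (ρ : TangentBundle (𝓡 n) M → ℝ) : Prop where
  smooth : ∀ φ ∈ IsManifold.maximalAtlas (𝓡 n) ∞ M, ∀ i,
    ContDiffOn ℝ ∞ (coordCovec φ b i) (coordDomain φ D)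
  ρ_ne_zero : ∀ u ∈ D, ρ u ≠ 0
  vCov_eq_zero : ∀ φ ∈ IsManifold.maximalAtlas (𝓡 n) ∞ M, ∀ z ∈ coordDomain φ D, ∀ i k,
    vCov (coordFun φ L) (coordCovec φ b) i k z = 0
  cartan_eq : ∀ φ ∈ IsManifold.maximalAtlas (𝓡 n) ∞ M, ∀ z ∈ coordDomain φ D, ∀ i j,
    coordFun φ L z * ∑ h, cartanC (coordFun φ L) h i j z * coordCovec φ b h z
      = coordFun φ ρ z * angular (coordFun φ L) i j z

/-- The Kropina change `*L = L² / (b_i y^i)`. -/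
def kropina (L : TangentBundle (𝓡 n) M → ℝ)
    (b : (u : TangentBundle (𝓡 n) M) → TangentSpace (𝓡 n) u.proj →L[ℝ] ℝ) :
    TangentBundle (𝓡 n) M → ℝ :=
  fun u => L u ^ 2 / b u u.2

/-- The Cartan connection coefficients `F^i_jk` of `(M, L)` and `(M, L')` are the same, in every
coordinate system. -/
def SameCartanCoefficients (D : Set (TangentBundle (𝓡 n) M))
    (L L' : TangentBundle (𝓡 n) M → ℝ) : Prop :=
  ∀ φ ∈ IsManifold.maximalAtlas (𝓡 n) ∞ M, ∀ z ∈ coordDomain φ D, ∀ i j k,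
    cartanF (coordFun φ L) i j k z = cartanF (coordFun φ L') i j k z

/-- `b` is parallel with respect to the Cartan connection of `(M, L)`: `b_{i|j} = 0`. -/
def IsParallel (D : Set (TangentBundle (𝓡 n) M)) (L : TangentBundle (𝓡 n) M → ℝ)
    (b : (u : TangentBundle (𝓡 n) M) → TangentSpace (𝓡 n) u.proj →L[ℝ] ℝ) : Prop :=
  ∀ φ ∈ IsManifold.maximalAtlas (𝓡 n) ∞ M, ∀ z ∈ coordDomain φ D, ∀ i j,
    hCov (coordFun φ L) (coordCovec φ b) i j z = 0

end Global

end Finsler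

end

/-! Write β = b_i y^i. The h-vector equations amount to ∂̇_k b_i = ρ ∂̇_i∂̇_k L (`IsHVector.dy_eq`).
Contraction with y kills the right side, so ∂̇_k β = b_k. The Kropina change is used as the product
identity *L β = L², and the proof applies δ_k to it and to its first two vertical derivatives.

If the coefficients agree, so do the nonlinear connections, since N^i_j = F^i_jk y^k, and hence the
operators δ_k. These annihilate L and *L, hence β, while ∂̇_i L and ∂̇_i *L are parallel. The once
differentiated identity then reduces to *L b_{i|k} = 0 (`parallel_of_cartanF_eq`).

Conversely, let b be parallel. If ∂̇_i b_j is parallel too, then so are *L, ∂̇_i *L, ∂̇_i∂̇_j *L and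
finally *g_ij, all for the connection of L. A symmetric, metrical connection without deflection is
unique (`cartan_unique`), so this is also the connection of *L. Since ∂̇_i∂̇_j L is parallel,
parallelism of ∂̇_i b_j follows once ρ is constant. Commuting vertical derivatives of b gives ∂̇_k ρ
= 0 for n ≥ 3 (for n = 2 it is assumed), and `dx_eq_zero_of_parallel` then gives ∂_k ρ = 0. For n =
1 the Hessian ∂̇_i∂̇_j L vanishes and ρ plays no role. -/

noncomputable section

namespace Finsler

/-! ### Directional derivatives on coordinate space -/

section Calculus

variable {n : ℕ} {U : Set (E n × E n)} {f g : E n × E n → ℝ} {z : E n × E n}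

/-- The derivative of `f` at `z` in the direction `v`. -/
def dir (v : E n × E n) (f : E n × E n → ℝ) (z : E n × E n) : ℝ := fderiv ℝ f z v

theorem dy_eq_dir (j : Fin n) (f : E n × E n → ℝ) : dy j f = dir (0, basisVec j) f := rfl

theorem dx_eq_dir (j : Fin n) (f : E n × E n → ℝ) : dx j f = dir (basisVec j, 0) f := rfl

@[simp] theorem basisVec_apply (i j : Fin n) :
    (basisVec i : E n) j = if j = i then 1 else 0 := by
  simp [basisVec]

theorem sum_smul_basisVec (y : E n) : ∑ i, y i • (basisVec i : E n) = y := by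
  ext j
  simp

theorem dir_sum_smul (f : E n × E n → ℝ) (z : E n × E n) (c : Fin n → ℝ)
    (v : Fin n → E n × E n) : dir (∑ i, c i • v i) f z = ∑ i, c i * dir (v i) f z := by
  simp [dir, map_sum]

/-- The horizontal lift of the `j`-th coordinate vector. -/
def horiz (L : E n × E n → ℝ) (j : Fin n) (z : E n × E n) : E n × E n :=
  (basisVec j, -∑ r, nonlin L r j z • basisVec r)

theorem delta_eq_dir (L : E n × E n → ℝ) (j : Fin n) (f : E n × E n → ℝ) (z : E n × E n) :
    delta L j f z = dir (horiz L j z) f z := by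
  have h : horiz L j z = (basisVec j, 0) -
      ∑ r, nonlin L r j z • ((0, basisVec r) : E n × E n) := by
    ext i <;> simp [horiz, Prod.fst_sum, Prod.snd_sum]
  simp only [delta, h, dx, dy, dir, map_sub, map_sum, map_smul, smul_eq_mul]

theorem horiz_snd (L : E n × E n → ℝ) (j : Fin n) (z : E n × E n) (i : Fin n) :
    (horiz L j z).2 i = -nonlin L i j z := by
  simp [horiz]

theorem _root_.ContDiffOn.dir (hU : IsOpen U) (hf : ContDiffOn ℝ ∞ f U) (v : E n × E n) :
    ContDiffOn ℝ ∞ (dir v f) U :=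
  (hf.fderiv_of_isOpen hU (m := ∞) (by simp)).clm_apply contDiffOn_const

theorem differentiableAt_of_smoothOn (hU : IsOpen U) (hf : ContDiffOn ℝ ∞ f U) (hz : z ∈ U) :
    DifferentiableAt ℝ f z :=
  (hf.contDiffAt (hU.mem_nhds hz)).differentiableAt (by simp)

theorem dir_congr (hU : IsOpen U) (h : ∀ w ∈ U, f w = g w) (hz : z ∈ U) (v : E n × E n) :
    dir v f z = dir v g z := by
  have : f =ᶠ[nhds z] g := Filter.eventually_of_mem (hU.mem_nhds hz) h
  rw [dir, dir, this.fderiv_eq]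

theorem dir_comm (hU : IsOpen U) (hf : ContDiffOn ℝ ∞ f U) (hz : z ∈ U) (u v : E n × E n) :
    dir u (dir v f) z = dir v (dir u f) z := by
  have hc := hf.contDiffAt (hU.mem_nhds hz)
  have hs := hc.isSymmSndFDerivAt (by
    rw [minSmoothness_of_isRCLikeNormedField]
    exact WithTop.coe_le_coe.2 le_top)
  have hd : DifferentiableAt ℝ (fderiv ℝ f) z :=
    (hc.fderiv_right (m := ∞) (by simp)).differentiableAt (by simp)
  have key : ∀ a b : E n × E n, dir a (dir b f) z = fderiv ℝ (fderiv ℝ f) z a b := by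
    intro a b
    change fderiv ℝ (fun w => fderiv ℝ f w b) z a = _
    rw [fderiv_clm_apply hd (differentiableAt_const _)]
    simp
  rw [key, key, hs.eq]

theorem dir_mul (hf : DifferentiableAt ℝ f z) (hg : DifferentiableAt ℝ g z) (v : E n × E n) :
    dir v (fun w => f w * g w) z = dir v f z * g z + f z * dir v g z := by
  simp [dir, fderiv_fun_mul hf hg]
  ring

theorem dir_add (hf : DifferentiableAt ℝ f z) (hg : DifferentiableAt ℝ g z) (v : E n × E n) :
    dir v (fun w => f w + g w) z = dir v f z + dir v g z := by
  simp [dir, fderiv_fun_add hf hg]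

theorem dir_sub (hf : DifferentiableAt ℝ f z) (hg : DifferentiableAt ℝ g z) (v : E n × E n) :
    dir v (fun w => f w - g w) z = dir v f z - dir v g z := by
  simp [dir, fderiv_fun_sub hf hg]

theorem dir_const (c : ℝ) (v : E n × E n) : dir v (fun _ => c) z = 0 := by
  simp [dir]

theorem dir_const_mul (hf : DifferentiableAt ℝ f z) (c : ℝ) (v : E n × E n) :
    dir v (fun w => c * f w) z = c * dir v f z := by
  rw [dir_mul (differentiableAt_const c) hf, dir_const]
  ring

theorem dir_sum {ι : Type*} (s : Finset ι) {f : ι → E n × E n → ℝ}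
    (hf : ∀ i ∈ s, DifferentiableAt ℝ (f i) z) (v : E n × E n) :
    dir v (fun w => ∑ i ∈ s, f i w) z = ∑ i ∈ s, dir v (f i) z := by
  simp [dir, fderiv_fun_sum hf]

theorem hasFDerivAt_snd_apply (j : Fin n) :
    HasFDerivAt (fun w : E n × E n => w.2 j)
      ((EuclideanSpace.proj j).comp (ContinuousLinearMap.snd ℝ (E n) (E n))) z :=
  ((EuclideanSpace.proj j).comp (ContinuousLinearMap.snd ℝ (E n) (E n))).hasFDerivAt

theorem dir_snd_apply (j : Fin n) (v : E n × E n) :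
    dir v (fun w : E n × E n => w.2 j) z = v.2 j := by
  simp [dir, (hasFDerivAt_snd_apply j).fderiv]

/-- Derivative of a contraction with the direction `y`. -/
theorem dir_sum_mul_snd {f : Fin n → E n × E n → ℝ} (hf : ∀ i, DifferentiableAt ℝ (f i) z)
    (v : E n × E n) :
    dir v (fun w => ∑ i, f i w * w.2 i) z = ∑ i, dir v (f i) z * z.2 i + ∑ i, f i z * v.2 i := by
  rw [dir_sum Finset.univ (f := fun i w => f i w * w.2 i)
    (fun i _ => (hf i).mul (hasFDerivAt_snd_apply i).differentiableAt) v, ← Finset.sum_add_distrib]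
  refine Finset.sum_congr rfl fun i _ => ?_
  rw [dir_mul (hf i) (hasFDerivAt_snd_apply i).differentiableAt, dir_snd_apply]

theorem sum_snd_mul_dy (f : E n × E n → ℝ) (z : E n × E n) :
    ∑ i, z.2 i * dy i f z = dir (0, z.2) f z := by
  have : ((0, z.2) : E n × E n) = ∑ i, z.2 i • ((0, basisVec i) : E n × E n) := by
    ext j
    · simp [Prod.fst_sum]
    · rw [Prod.snd_sum]
      simp
  rw [this, dir_sum_smul]
  rfl

end Calculus

/-! ### Homogeneity, fundamental tensor and Cartan tensor -/

section LocalFinsler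

variable {n : ℕ} {U : Set (E n × E n)} {L : E n × E n → ℝ} {z : E n × E n}

/-- Coordinate form of a Finsler fundamental function on an open set `U`. -/
structure IsFinslerOn (U : Set (E n × E n)) (L : E n × E n → ℝ) : Prop where
  isOpen : IsOpen U
  pos : ∀ z ∈ U, 0 < L z
  smooth : ContDiffOn ℝ ∞ L U
  homogeneous : ∀ z ∈ U, ∀ t : ℝ, 0 < t → L (z.1, t • z.2) = t * L z
  nonsingular : ∀ z ∈ U, (metricMatrix L z).det ≠ 0

/-- `∂̇_i ∂̇_j L`. -/
def hess (L : E n × E n → ℝ) (i j : Fin n) : E n × E n → ℝ := dy i (dy j L)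

/-- The Christoffel symbols with lowered first index. -/
def christoffelLower (L : E n × E n → ℝ) (i j k : Fin n) (z : E n × E n) : ℝ :=
  (1 / 2) * (dx j (metric L i k) z + dx k (metric L i j) z - dx i (metric L j k) z)

theorem _root_.ContDiffOn.dy (hU : IsOpen U) (hL : ContDiffOn ℝ ∞ L U) (i : Fin n) :
    ContDiffOn ℝ ∞ (Finsler.dy i L) U := hL.dir hU _

theorem _root_.ContDiffOn.hess (hU : IsOpen U) (hL : ContDiffOn ℝ ∞ L U) (i j : Fin n) :
    ContDiffOn ℝ ∞ (Finsler.hess L i j) U := (hL.dy hU j).dy hU i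

theorem sum_metric_mul_sum_metricInv (hdet : (metricMatrix L z).det ≠ 0) (a : Fin n → ℝ)
    (i : Fin n) : ∑ s, metric L i s z * ∑ r, metricInv L s r z * a r = a i := by
  have h : (metricMatrix L z).mulVec ((metricMatrix L z)⁻¹.mulVec a) = a := by
    rw [Matrix.mulVec_mulVec, Matrix.mul_nonsing_inv _ (isUnit_iff_ne_zero.2 hdet),
      Matrix.one_mulVec]
  exact congrFun h i

/-- Identities with an upper index are checked after lowering it, so the inverse matrix never has to
be differentiated. -/
theorem eq_of_sum_metric_eq (hdet : (metricMatrix L z).det ≠ 0) {a b : Fin n → ℝ}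
    (h : ∀ i, ∑ s, metric L i s z * a s = ∑ s, metric L i s z * b s) (i : Fin n) : a i = b i := by
  have h' : (metricMatrix L z).mulVec a = (metricMatrix L z).mulVec b := funext h
  exact congrFun (Matrix.mulVec_injective_of_isUnit
    ((Matrix.isUnit_iff_isUnit_det _).2 (isUnit_iff_ne_zero.2 hdet)) h') i

theorem lower_christoffel (hdet : (metricMatrix L z).det ≠ 0) (i j k : Fin n) :
    ∑ s, metric L i s z * christoffel L s j k z = christoffelLower L i j k z := by
  rw [← sum_metric_mul_sum_metricInv hdet (fun r => christoffelLower L r j k z) i]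
  refine Finset.sum_congr rfl fun s _ => congrArg _ (Finset.sum_congr rfl fun r _ => ?_)
  rw [christoffelLower]
  ring

theorem lower_cartanC (hdet : (metricMatrix L z).det ≠ 0) (i j k : Fin n) :
    ∑ s, metric L i s z * cartanC L s j k z = cartanLower L j k i z :=
  sum_metric_mul_sum_metricInv hdet (fun r => cartanLower L j k r z) i

theorem lower_cartanF (hdet : (metricMatrix L z).det ≠ 0) (i j k : Fin n) :
    ∑ s, metric L i s z * cartanF L s j k z =
      (1 / 2) * (delta L j (metric L i k) z + delta L k (metric L i j) z
        - delta L i (metric L j k) z) := by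
  rw [← sum_metric_mul_sum_metricInv hdet (fun r => (1 / 2) * (delta L j (metric L r k) z
    + delta L k (metric L r j) z - delta L r (metric L j k) z)) i]
  refine Finset.sum_congr rfl fun s _ => congrArg _ (Finset.sum_congr rfl fun r _ => ?_)
  ring

theorem lower_spray (hdet : (metricMatrix L z).det ≠ 0) (i : Fin n) :
    ∑ s, metric L i s z * spray L s z =
      ∑ j, (∑ k, christoffelLower L i j k z * z.2 k) * z.2 j := by
  simp only [← lower_christoffel hdet, spray, Finset.mul_sum, Finset.sum_mul]
  rw [Finset.sum_comm]
  refine Finset.sum_congr rfl fun j _ => ?_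
  rw [Finset.sum_comm]
  refine Finset.sum_congr rfl fun k _ => Finset.sum_congr rfl fun s _ => ?_
  ring

theorem lower_nonlin (hdet : (metricMatrix L z).det ≠ 0) (i j : Fin n) :
    ∑ s, metric L i s z * nonlin L s j z =
      ∑ k, christoffelLower L i j k z * z.2 k - ∑ r, cartanLower L j r i z * spray L r z := by
  simp only [← lower_christoffel hdet, ← lower_cartanC hdet, nonlin, mul_sub,
    Finset.sum_sub_distrib, Finset.mul_sum, Finset.sum_mul]
  congr 1
  · rw [Finset.sum_comm]
    simp only [mul_assoc]
  · rw [Finset.sum_comm]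
    simp only [mul_assoc]

namespace IsFinslerOn

variable (hL : IsFinslerOn U L)

include hL

theorem differentiableAt (hz : z ∈ U) : DifferentiableAt ℝ L z :=
  differentiableAt_of_smoothOn hL.isOpen hL.smooth hz

theorem differentiableAt_dy (hz : z ∈ U) (i : Fin n) : DifferentiableAt ℝ (dy i L) z :=
  differentiableAt_of_smoothOn hL.isOpen (hL.smooth.dy hL.isOpen i) hz

theorem differentiableAt_hess (hz : z ∈ U) (i j : Fin n) : DifferentiableAt ℝ (hess L i j) z :=
  differentiableAt_of_smoothOn hL.isOpen (hL.smooth.hess hL.isOpen i j) hz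

/-- Euler's relation: differentiate L(x, ty) = t L(x, y) at t = 1. -/
theorem sum_dy_mul_snd (hz : z ∈ U) : ∑ i, dy i L z * z.2 i = L z := by
  have h1 : HasDerivAt (fun t : ℝ => ((z.1, t • z.2) : E n × E n)) (0, z.2) 1 := by
    refine (hasDerivAt_const _ _).prodMk ?_
    simpa using (hasDerivAt_id (1 : ℝ)).smul_const z.2
  have hz1 : ((z.1, (1 : ℝ) • z.2) : E n × E n) = z := by simp
  have h2 : HasDerivAt (fun t : ℝ => L (z.1, t • z.2)) (dir (0, z.2) L z) 1 := by
    refine HasFDerivAt.comp_hasDerivAt (f := fun t : ℝ => ((z.1, t • z.2) : E n × E n))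
      (1 : ℝ) (l := L) ?_ h1
    rw [hz1]
    exact (hL.differentiableAt hz).hasFDerivAt
  have h3 : HasDerivAt (fun t : ℝ => L (z.1, t • z.2)) (L z) 1 := by
    have : HasDerivAt (fun t : ℝ => t * L z) (L z) 1 := by
      simpa using (hasDerivAt_id (1 : ℝ)).mul_const (L z)
    refine this.congr_of_eventuallyEq ?_
    filter_upwards [lt_mem_nhds (zero_lt_one (α := ℝ))] with t ht
    exact hL.homogeneous z hz t ht
  rw [← h2.unique h3, ← sum_snd_mul_dy]
  exact Finset.sum_congr rfl fun i _ => mul_comm _ _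

theorem hess_symm (hz : z ∈ U) (i j : Fin n) : hess L i j z = hess L j i z :=
  dir_comm hL.isOpen hL.smooth hz _ _

/-- Vertical derivative of Euler's relation; the term coming from ∂̇_i y^j cancels the right side.
-/
theorem sum_hess_mul_snd (hz : z ∈ U) (i : Fin n) : ∑ j, hess L i j z * z.2 j = 0 := by
  have h := dir_congr hL.isOpen (f := fun w => ∑ j, dy j L w * w.2 j)
    (fun w hw => hL.sum_dy_mul_snd hw) hz (0, basisVec i)
  rw [dir_sum_mul_snd (fun j => hL.differentiableAt_dy hz j)] at h
  simpa [dy_eq_dir, hess] using h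

theorem sum_hess_mul_snd' (hz : z ∈ U) (i : Fin n) : ∑ j, hess L j i z * z.2 j = 0 := by
  simpa only [hL.hess_symm hz i] using hL.sum_hess_mul_snd hz i

theorem metric_eq (hz : z ∈ U) (i j : Fin n) :
    metric L i j z = dy i L z * dy j L z + L z * hess L i j z := by
  have h1 : ∀ w ∈ U, dy j (fun w => L w ^ 2) w = 2 * (L w * dy j L w) := by
    intro w hw
    have := dir_mul (hL.differentiableAt hw) (hL.differentiableAt hw) (0, basisVec j)
    simp only [← pow_two] at this
    rw [dy_eq_dir, this, dy_eq_dir]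
    ring
  have hd := hL.differentiableAt hz
  have hd' := hL.differentiableAt_dy hz j
  rw [metric, dy_eq_dir i, dir_congr hL.isOpen h1 hz,
    dir_const_mul (f := fun w => L w * dy j L w) (hd.mul hd'),
    dir_mul hd hd', ← dy_eq_dir, ← dy_eq_dir, hess]
  ring

theorem angular_eq (hz : z ∈ U) (i j : Fin n) : angular L i j z = L z * hess L i j z := by
  rw [angular, hL.metric_eq hz]
  ring

theorem metric_smooth (i j : Fin n) : ContDiffOn ℝ ∞ (metric L i j) U :=
  contDiffOn_const.mul (((hL.smooth.pow 2).dy hL.isOpen j).dy hL.isOpen i)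

theorem differentiableAt_metric (hz : z ∈ U) (i j : Fin n) :
    DifferentiableAt ℝ (metric L i j) z :=
  differentiableAt_of_smoothOn hL.isOpen (hL.metric_smooth i j) hz

theorem metric_symm (hz : z ∈ U) (i j : Fin n) : metric L i j z = metric L j i z := by
  rw [hL.metric_eq hz, hL.metric_eq hz, hL.hess_symm hz i j]
  ring

theorem dir_metric_symm (hz : z ∈ U) (v : E n × E n) (i j : Fin n) :
    dir v (metric L i j) z = dir v (metric L j i) z :=
  dir_congr hL.isOpen (fun _ hw => hL.metric_symm hw i j) hz v

theorem sum_metric_mul_snd (hz : z ∈ U) (i : Fin n) :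
    ∑ j, metric L i j z * z.2 j = L z * dy i L z := by
  simp only [hL.metric_eq hz, add_mul, Finset.sum_add_distrib, mul_assoc, ← Finset.mul_sum]
  rw [hL.sum_dy_mul_snd hz, hL.sum_hess_mul_snd hz]
  ring

theorem cartanLower_symm (hz : z ∈ U) (i j k : Fin n) :
    cartanLower L i j k z = cartanLower L j i k z := by
  rw [cartanLower, cartanLower, dy_eq_dir, dy_eq_dir, hL.dir_metric_symm hz _ i j]

/-- C_ijk is a quarter of the third vertical derivative of L², and ∂̇_i, ∂̇_k commute on ∂̇_j L². -/
theorem cartanLower_swap (hz : z ∈ U) (i j k : Fin n) :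
    cartanLower L i j k z = cartanLower L k j i z := by
  have hs := (hL.smooth.pow 2).dy hL.isOpen j
  have key : ∀ a b : Fin n, dy a (metric L b j) z
      = (1 / 2) * dy a (dy b (dy j fun w => L w ^ 2)) z := by
    intro a b
    exact dir_const_mul (differentiableAt_of_smoothOn hL.isOpen (hs.dy hL.isOpen b) hz) _ _
  rw [cartanLower, cartanLower, key, key]
  congr 2
  exact dir_comm hL.isOpen hs hz _ _

theorem cartanLower_rotate (hz : z ∈ U) (i j k : Fin n) :
    cartanLower L i j k z = cartanLower L j k i z := by
  rw [hL.cartanLower_symm hz i j k, hL.cartanLower_swap hz j i k, hL.cartanLower_symm hz k i j,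
    hL.cartanLower_swap hz i k j]

/-- Vertical derivative of g_ij y^j = L l_i: both sides contribute a g_ik, which cancels. -/
theorem sum_cartanLower_mul_snd (hz : z ∈ U) (i k : Fin n) :
    ∑ j, cartanLower L i j k z * z.2 j = 0 := by
  have h := dir_congr hL.isOpen (f := fun w => ∑ j, metric L i j w * w.2 j)
    (fun w hw => hL.sum_metric_mul_snd hw i) hz (0, basisVec k)
  rw [dir_sum_mul_snd (fun j => hL.differentiableAt_metric hz i j),
    dir_mul (hL.differentiableAt hz) (hL.differentiableAt_dy hz i)] at h
  simp only [← dy_eq_dir, basisVec_apply, mul_ite, mul_one, mul_zero, Finset.sum_ite_eq',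
    Finset.mem_univ, if_true] at h
  rw [hL.metric_eq hz i k, hL.hess_symm hz i k, hess] at h
  simp only [cartanLower, mul_assoc, ← Finset.mul_sum]
  linarith

end IsFinslerOn

/-! ### Characterisation of the Cartan connection -/

/-- The Cartan connection is the only metrical and h-symmetric connection with vanishing
deflection. -/
theorem IsFinslerOn.cartan_unique (hL : IsFinslerOn U L) (hz : z ∈ U) {N : Fin n → Fin n → ℝ}
    {F : Fin n → Fin n → Fin n → ℝ} (hsymm : ∀ i j k, F i j k = F i k j)
    (hdefl : ∀ i j, ∑ k, F i j k * z.2 k = N i j)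
    (hmet : ∀ i j k, dx k (metric L i j) z - ∑ r, N r k * dy r (metric L i j) z =
      ∑ r, metric L j r z * F r i k + ∑ r, metric L i r z * F r j k) :
    (∀ i j, nonlin L i j z = N i j) ∧ ∀ i j k, cartanF L i j k z = F i j k := by
  have hdet := hL.nonsingular z hz
  set A : Fin n → Fin n → Fin n → ℝ := fun i j k => ∑ r, metric L i r z * F r j k with hA
  have hAs : ∀ i j k, A i j k = A i k j := fun i j k => by simp only [hA, hsymm _ j k]
  have hC : ∀ i j k, cartanLower L i j k z = cartanLower L i k j z := fun i j k => by
    rw [hL.cartanLower_rotate hz, hL.cartanLower_rotate hz, hL.cartanLower_symm hz]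
  have hdx : ∀ i j k, dx k (metric L i j) z =
      2 * ∑ r, N r k * cartanLower L i j r z + A j i k + A i j k := by
    intro i j k
    have h := hmet i j k
    have h2 : ∑ r, N r k * dy r (metric L i j) z = 2 * ∑ r, N r k * cartanLower L i j r z := by
      rw [Finset.mul_sum]
      exact Finset.sum_congr rfl fun r _ => by rw [cartanLower]; ring
    rw [h2] at h
    simp only [hA]
    linarith
  -- Christoffel's trick: by symmetry of F, the alternating sum of the ∂g leaves a single A, plus
  -- Cartan terms.
  have hΓ : ∀ i j k, christoffelLower L i j k z = A i j k + ∑ r, N r j * cartanLower L i k r z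
      + ∑ r, N r k * cartanLower L i j r z - ∑ r, N r i * cartanLower L j k r z := by
    intro i j k
    rw [christoffelLower, hdx, hdx, hdx, hAs i k j, hAs k i j, hAs j i k]
    ring
  have hAy : ∀ i j, ∑ k, A i j k * z.2 k = ∑ s, metric L i s z * N s j := by
    intro i j
    simp only [hA, ← hdefl, Finset.sum_mul, Finset.mul_sum]
    rw [Finset.sum_comm]
    simp only [mul_assoc]
  have hCy : ∀ i a, ∑ k, (∑ r, N r a * cartanLower L i k r z) * z.2 k = 0 := by
    intro i a
    simp only [Finset.sum_mul]
    rw [Finset.sum_comm]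
    simp only [mul_assoc, ← Finset.mul_sum, hL.sum_cartanLower_mul_snd hz, mul_zero,
      Finset.sum_const_zero]
  have hNy : ∀ i j, ∑ k, (∑ r, N r k * cartanLower L i j r z) * z.2 k =
      ∑ r, cartanLower L i j r z * ∑ k, N r k * z.2 k := by
    intro i j
    simp only [Finset.sum_mul, Finset.mul_sum]
    rw [Finset.sum_comm]
    exact Finset.sum_congr rfl fun r _ => Finset.sum_congr rfl fun k _ => by ring
  have hΓy : ∀ i j, ∑ k, christoffelLower L i j k z * z.2 k = ∑ s, metric L i s z * N s j
      + ∑ r, cartanLower L i j r z * ∑ k, N r k * z.2 k := by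
    intro i j
    simp only [hΓ, add_mul, sub_mul, Finset.sum_add_distrib, Finset.sum_sub_distrib, hAy, hCy, hNy]
    ring
  -- A second contraction with y kills the Cartan terms. With the spray known, the formula defining
  -- `nonlin` returns N.
  have hspray : ∀ i, spray L i z = ∑ k, N i k * z.2 k := by
    refine eq_of_sum_metric_eq hdet fun i => ?_
    rw [lower_spray hdet]
    simp only [hΓy, add_mul, Finset.sum_add_distrib, Finset.sum_mul]
    have h1 : ∑ x, ∑ r, cartanLower L i x r z * (∑ k, N r k * z.2 k) * z.2 x = 0 := by
      rw [Finset.sum_comm]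
      refine Finset.sum_eq_zero fun r _ => ?_
      rw [← zero_mul (∑ k, N r k * z.2 k), ← hL.sum_cartanLower_mul_snd hz i r, Finset.sum_mul]
      exact Finset.sum_congr rfl fun k _ => by ring
    rw [h1, add_zero, Finset.sum_comm]
    simp only [mul_assoc, ← Finset.mul_sum]
  have hN : ∀ i j, nonlin L i j z = N i j := by
    intro i j
    refine eq_of_sum_metric_eq hdet (a := fun i => nonlin L i j z) (b := fun i => N i j)
      (fun i => ?_) i
    rw [lower_nonlin hdet, hΓy]
    simp only [hspray, ← hL.cartanLower_rotate hz i j]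
    ring
  refine ⟨hN, fun i j k => ?_⟩
  refine eq_of_sum_metric_eq hdet (a := fun i => cartanF L i j k z) (b := fun i => F i j k)
    (fun i => ?_) i
  rw [lower_cartanF hdet]
  simp only [delta, hN, hmet]
  change 1 / 2 * (A k i j + A i k j + (A j i k + A i j k) - (A k j i + A j k i)) = A i j k
  rw [hAs i k j, hAs k i j, hAs j i k]
  ring

namespace IsFinslerOn

variable (hL : IsFinslerOn U L)

include hL

theorem cartanF_symm (hz : z ∈ U) (i j k : Fin n) : cartanF L i j k z = cartanF L i k j z := by
  refine Finset.sum_congr rfl fun r _ => ?_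
  rw [delta_eq_dir L r, hL.dir_metric_symm hz, ← delta_eq_dir]
  ring

theorem delta_metric (hz : z ∈ U) (i j k : Fin n) : delta L k (metric L i j) z =
    ∑ r, metric L j r z * cartanF L r i k z + ∑ r, metric L i r z * cartanF L r j k z := by
  rw [lower_cartanF (hL.nonsingular z hz), lower_cartanF (hL.nonsingular z hz)]
  simp only [delta_eq_dir]
  rw [hL.dir_metric_symm hz _ j i]
  ring

/-- The Cartan connection has no deflection. -/
theorem sum_cartanF_mul_snd (hz : z ∈ U) (i j : Fin n) :
    ∑ k, cartanF L i j k z * z.2 k = nonlin L i j z := by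
  have hdet := hL.nonsingular z hz
  refine eq_of_sum_metric_eq hdet (a := fun i => ∑ k, cartanF L i j k z * z.2 k)
      (b := fun i => nonlin L i j z) (fun i => ?_) i
  have h1 : ∑ s, metric L i s z * ∑ k, cartanF L s j k z * z.2 k =
      ∑ k, (∑ s, metric L i s z * cartanF L s j k z) * z.2 k := by
    simp only [Finset.sum_mul, Finset.mul_sum]
    rw [Finset.sum_comm]
    simp only [mul_assoc]
  have hC : ∀ i k r, dy r (metric L i k) z = 2 * cartanLower L i k r z := fun i k r => by
    rw [cartanLower]; ring
  -- Of the three vertical corrections in the δg, two vanish on contraction with y; the third,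
  -- `hNC`, is the Cartan-spray term of N.
  have hCy : ∀ i a, ∑ k, (∑ r, nonlin L r a z * (2 * cartanLower L i k r z)) * z.2 k = 0 := by
    intro i a
    simp only [Finset.sum_mul]
    rw [Finset.sum_comm]
    refine Finset.sum_eq_zero fun r _ => ?_
    have : 2 * nonlin L r a z * ∑ k, cartanLower L i k r z * z.2 k = 0 := by
      rw [hL.sum_cartanLower_mul_snd hz, mul_zero]
    rw [← this, Finset.mul_sum]
    exact Finset.sum_congr rfl fun k _ => by ring
  have hNy : ∀ r, ∑ k, nonlin L r k z * z.2 k = spray L r z := by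
    intro r
    simp only [nonlin, sub_mul, Finset.sum_sub_distrib, Finset.sum_mul]
    have h0 : ∑ k, ∑ s, cartanC L r k s z * spray L s z * z.2 k = 0 := by
      simp only [cartanC, Finset.sum_mul]
      rw [Finset.sum_comm]
      refine Finset.sum_eq_zero fun s _ => ?_
      rw [Finset.sum_comm]
      refine Finset.sum_eq_zero fun t _ => ?_
      have : metricInv L r t z * spray L s z * ∑ k, cartanLower L s k t z * z.2 k = 0 := by
        rw [hL.sum_cartanLower_mul_snd hz, mul_zero]
      rw [← this, Finset.mul_sum]
      refine Finset.sum_congr rfl fun k _ => ?_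
      rw [hL.cartanLower_symm hz s k]
      ring
    rw [h0, sub_zero, spray]
    refine Finset.sum_congr rfl fun j _ => Finset.sum_congr rfl fun k _ => ?_
    ring
  have hNC : ∑ k, (∑ r, nonlin L r k z * (2 * cartanLower L i j r z)) * z.2 k =
      2 * ∑ r, cartanLower L j r i z * spray L r z := by
    simp only [← hNy, Finset.sum_mul, Finset.mul_sum]
    rw [Finset.sum_comm]
    refine Finset.sum_congr rfl fun r _ => Finset.sum_congr rfl fun k _ => ?_
    rw [hL.cartanLower_rotate hz i j r]
    ring
  have hΓ : ∑ k, christoffelLower L i j k z * z.2 k = (1 / 2) * (∑ k, dx j (metric L i k) z * z.2 k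
      + ∑ k, dx k (metric L i j) z * z.2 k - ∑ k, dx i (metric L j k) z * z.2 k) := by
    simp only [christoffelLower, ← Finset.sum_add_distrib, ← Finset.sum_sub_distrib,
      Finset.mul_sum]
    exact Finset.sum_congr rfl fun k _ => by ring
  rw [h1, lower_nonlin hdet, hΓ]
  simp only [lower_cartanF hdet, delta, hC, mul_assoc, ← Finset.mul_sum, add_mul, sub_mul,
    Finset.sum_add_distrib, Finset.sum_sub_distrib]
  simp only [hCy, hNC]
  ring

theorem delta_snd_eq (hz : z ∈ U) (i k : Fin n) :
    (horiz L k z).2 i = -∑ s, cartanF L i s k z * z.2 s := by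
  rw [horiz_snd, ← hL.sum_cartanF_mul_snd hz]
  simp only [hL.cartanF_symm hz i k]

/-- The direction y is itself parallel: δ_k y^i = -N^i_k = -F^i_sk y^s. -/
theorem delta_sum_mul_snd (hz : z ∈ U) {f : Fin n → E n × E n → ℝ}
    (hf : ∀ i, DifferentiableAt ℝ (f i) z) (k : Fin n) :
    delta L k (fun w => ∑ i, f i w * w.2 i) z = ∑ i, hCov L f i k z * z.2 i := by
  rw [delta_eq_dir, dir_sum_mul_snd hf]
  simp only [hCov, delta_eq_dir, sub_mul, Finset.sum_sub_distrib, hL.delta_snd_eq hz,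
    Finset.mul_sum, mul_neg, Finset.sum_neg_distrib, Finset.sum_mul, ← sub_eq_add_neg]
  congr 1
  rw [Finset.sum_comm]
  simp only [mul_assoc]

end IsFinslerOn

end LocalFinsler

section LocalKropina

variable {n : ℕ} {U : Set (E n × E n)} {L P : E n × E n → ℝ} {z : E n × E n}

namespace IsFinslerOn

/-! ### Parallelism of L and its vertical derivatives -/

section Parallel

variable (hL : IsFinslerOn U L)

include hL

/-- L l_i = g_ij y^j, where both g and y are parallel. -/
theorem delta_mul_dy (hz : z ∈ U) (i k : Fin n) : delta L k (fun w => L w * dy i L w) z =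
    ∑ r, L z * dy r L z * cartanF L r i k z := by
  have h1 : ∀ w ∈ U, L w * dy i L w = ∑ j, metric L i j w * w.2 j :=
    fun w hw => (hL.sum_metric_mul_snd hw i).symm
  rw [delta_eq_dir, dir_congr hL.isOpen h1 hz, ← delta_eq_dir,
    hL.delta_sum_mul_snd hz (fun j => hL.differentiableAt_metric hz i j)]
  have h2 : ∀ j, hCov L (metric L i) j k z = ∑ r, metric L j r z * cartanF L r i k z := by
    intro j
    rw [hCov, hL.delta_metric hz]
    ring
  simp only [h2, ← hL.sum_metric_mul_snd hz, Finset.sum_mul]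
  rw [Finset.sum_comm]
  refine Finset.sum_congr rfl fun r _ => Finset.sum_congr rfl fun j _ => ?_
  rw [hL.metric_symm hz j r]
  ring

/-- The fundamental function is horizontally constant. -/
theorem delta_self (hz : z ∈ U) (k : Fin n) : delta L k L z = 0 := by
  have hd := hL.differentiableAt hz
  have h1 : ∀ w ∈ U, L w * L w = ∑ i, (fun w => L w * dy i L w) w * w.2 i := by
    intro w hw
    simp only [mul_assoc, ← Finset.mul_sum, hL.sum_dy_mul_snd hw]
  have h2 : delta L k (fun w => L w * L w) z = 0 := by
    rw [delta_eq_dir, dir_congr hL.isOpen h1 hz, ← delta_eq_dir,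
      hL.delta_sum_mul_snd hz (fun i => hd.fun_mul (hL.differentiableAt_dy hz i))]
    refine Finset.sum_eq_zero fun i _ => ?_
    rw [hCov, hL.delta_mul_dy hz, sub_self, zero_mul]
  rw [delta_eq_dir, dir_mul hd hd, ← delta_eq_dir] at h2
  have := (hL.pos z hz).ne'
  have h3 : L z * delta L k L z = 0 := by linarith
  exact (mul_eq_zero.1 h3).resolve_left this

/-- The covector `l_i = ∂̇_i L` is parallel. -/
theorem delta_dy (hz : z ∈ U) (i k : Fin n) :
    delta L k (dy i L) z = ∑ r, dy r L z * cartanF L r i k z := by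
  have h := hL.delta_mul_dy hz i k
  rw [delta_eq_dir, dir_mul (hL.differentiableAt hz) (hL.differentiableAt_dy hz i),
    ← delta_eq_dir, ← delta_eq_dir, hL.delta_self hz] at h
  simp only [mul_assoc, ← Finset.mul_sum] at h
  refine mul_left_cancel₀ (hL.pos z hz).ne' ?_
  linarith

/-- The tensor `∂̇_i ∂̇_j L` is parallel. -/
theorem delta_hess (hz : z ∈ U) (i j k : Fin n) : delta L k (hess L i j) z =
    ∑ r, hess L r j z * cartanF L r i k z + ∑ r, hess L i r z * cartanF L r j k z := by
  have hd := hL.differentiableAt hz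
  have hdi := hL.differentiableAt_dy hz i
  have hdj := hL.differentiableAt_dy hz j
  have hh := hL.differentiableAt_hess hz i j
  have h := hL.delta_metric hz i j k
  rw [delta_eq_dir, dir_congr hL.isOpen (fun w hw => hL.metric_eq hw i j) hz,
    dir_add (hdi.fun_mul hdj) (hd.fun_mul hh), dir_mul hdi hdj, dir_mul hd hh] at h
  simp only [← delta_eq_dir, hL.delta_self hz, hL.delta_dy hz, hL.metric_eq hz, add_mul,
    Finset.sum_add_distrib, mul_assoc, ← Finset.mul_sum] at h
  simp only [hL.hess_symm hz _ j]
  refine mul_left_cancel₀ (hL.pos z hz).ne' ?_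
  linear_combination h

end Parallel

/-! ### Trace and rank of the angular metric -/

section Rank

variable (hL : IsFinslerOn U L)

include hL

/-- L ∂̇_j∂̇_k L = g_jk - l_j l_k, and raising the index of l_j gives y^i / L. -/
theorem sum_metricInv_mul_hess (hz : z ∈ U) (i k : Fin n) :
    ∑ j, metricInv L i j z * (L z * hess L j k z) =
      (if i = k then 1 else 0) - z.2 i * dy k L z / L z := by
  refine eq_of_sum_metric_eq (hL.nonsingular z hz)
    (a := fun i => ∑ j, metricInv L i j z * (L z * hess L j k z))
    (b := fun i => (if i = k then 1 else 0) - z.2 i * dy k L z / L z) (fun i => ?_) i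
  rw [sum_metric_mul_sum_metricInv (hL.nonsingular z hz)]
  have h : ∑ s, metric L i s z * (z.2 s * dy k L z / L z) = dy i L z * dy k L z := by
    have : ∑ s, metric L i s z * (z.2 s * dy k L z / L z) =
        (∑ s, metric L i s z * z.2 s) * (dy k L z / L z) := by
      rw [Finset.sum_mul]
      exact Finset.sum_congr rfl fun s _ => by ring
    rw [this, hL.sum_metric_mul_snd hz]
    have := (hL.pos z hz).ne'
    field_simp
  simp only [mul_sub, Finset.sum_sub_distrib, h, mul_ite, mul_one, mul_zero,
    Finset.sum_ite_eq', Finset.mem_univ, if_true]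
  rw [hL.metric_eq hz]
  ring

theorem trace_hess (hz : z ∈ U) :
    ∑ k, ∑ j, metricInv L k j z * (L z * hess L j k z) = n - 1 := by
  simp only [hL.sum_metricInv_mul_hess hz, Finset.sum_sub_distrib, if_true, Finset.sum_const,
    Finset.card_univ, Fintype.card_fin, ← Finset.sum_div, nsmul_eq_mul, mul_one]
  simp only [mul_comm (z.2 _), hL.sum_dy_mul_snd hz, div_self (hL.pos z hz).ne']

theorem exists_hess_ne_zero (hn : n ≠ 1) (hz : z ∈ U) : ∃ i j, hess L i j z ≠ 0 := by
  by_contra! h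
  have := hL.trace_hess hz
  simp only [h, mul_zero, Finset.sum_const_zero] at this
  exact hn (by exact_mod_cast (sub_eq_zero.1 this.symm))

theorem hess_eq_zero (hn : n = 1) (hz : z ∈ U) (i j : Fin n) : hess L i j z = 0 := by
  subst hn
  have h1 := hL.sum_hess_mul_snd hz i
  have h2 := hL.sum_dy_mul_snd hz
  have h3 := hL.pos z hz
  rw [Fin.sum_univ_one] at h1 h2
  rw [Subsingleton.elim j 0]
  refine (mul_eq_zero.1 h1).resolve_right fun h => ?_
  rw [h, mul_zero] at h2
  exact h3.ne h2

theorem sum_mul_snd_eq_zero_of_hess (hn : n ≠ 1) (hz : z ∈ U) {r : Fin n → ℝ}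
    (h : ∀ i j k, r k * hess L i j z = r j * hess L i k z) : ∑ k, r k * z.2 k = 0 := by
  obtain ⟨i, j, hij⟩ := hL.exists_hess_ne_zero hn hz
  have : (∑ k, r k * z.2 k) * hess L i j z = r j * ∑ k, hess L i k z * z.2 k := by
    rw [Finset.sum_mul, Finset.mul_sum]
    refine Finset.sum_congr rfl fun k _ => ?_
    rw [← mul_assoc, ← h]
    ring
  rw [hL.sum_hess_mul_snd hz, mul_zero] at this
  exact (mul_eq_zero.1 this).resolve_right hij

/-- Tracing over i, j with g^{ij} gives (n - 1) r_k = r_k, because r_j y^j = 0; hence (n - 2) r_k =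
0. -/
theorem eq_zero_of_hess (hn : n ≠ 1) (hn' : n ≠ 2) (hz : z ∈ U) {r : Fin n → ℝ}
    (h : ∀ i j k, r k * hess L i j z = r j * hess L i k z) (k : Fin n) : r k = 0 := by
  have h0 := hL.sum_mul_snd_eq_zero_of_hess hn hz h
  have h1 : r k * ∑ j, ∑ i, metricInv L j i z * (L z * hess L i j z) =
      ∑ j, r j * ∑ i, metricInv L j i z * (L z * hess L i k z) := by
    simp only [Finset.mul_sum]
    refine Finset.sum_congr rfl fun j _ => Finset.sum_congr rfl fun i _ => ?_
    linear_combination metricInv L j i z * L z * h i j k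
  have h2 : ∑ j, r j * (z.2 j * dy k L z / L z) = 0 := by
    have : (∑ j, r j * z.2 j) * (dy k L z / L z) = 0 := by rw [h0, zero_mul]
    rw [← this, Finset.sum_mul]
    exact Finset.sum_congr rfl fun s _ => by ring
  rw [hL.trace_hess hz] at h1
  simp only [hL.sum_metricInv_mul_hess hz, mul_sub, Finset.sum_sub_distrib, h2, mul_ite, mul_one,
    mul_zero, Finset.sum_ite_eq', Finset.mem_univ, if_true] at h1
  have h3 : r k * ((n : ℝ) - 2) = 0 := by linarith
  refine (mul_eq_zero.1 h3).resolve_right fun h4 => hn' ?_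
  exact_mod_cast sub_eq_zero.1 h4

end Rank

/-! ### The scalar ρ of an h-vector -/

section HVector

variable {b : Fin n → E n × E n → ℝ} {ρ : E n × E n → ℝ} (hL : IsFinslerOn U L)
  (hb : ∀ i, ContDiffOn ℝ ∞ (b i) U) (hv : ∀ z ∈ U, ∀ i k, dy k (b i) z = ρ z * hess L i k z)

include hL hb hv

/-- Near each point ρ is a quotient of ∂̇_k b_i by a nonvanishing entry of the Hessian, so its
smoothness need not be assumed. -/
theorem smooth_of_dy_eq (hn : n ≠ 1) : ContDiffOn ℝ ∞ ρ U := by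
  intro z hz
  obtain ⟨i, k, hik⟩ := hL.exists_hess_ne_zero hn hz
  have hU := hL.isOpen.mem_nhds hz
  have hh := (hL.smooth.hess hL.isOpen i k).contDiffAt hU
  have h1 : ContDiffAt ℝ ∞ (fun w => dy k (b i) w / hess L i k w) z :=
    (((hb i).dy hL.isOpen k).contDiffAt hU).div hh hik
  refine (h1.congr_of_eventuallyEq ?_).contDiffWithinAt
  filter_upwards [hU, hh.continuousAt.eventually_ne hik] with w hw hne
  rw [hv w hw, mul_div_cancel_right₀ _ hne]

/-- In dimension at least three, the scalar of an h-vector does not depend on the direction. -/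
theorem dy_eq_zero_of_dy_eq (hn : n ≠ 1) (hn' : n ≠ 2) (hz : z ∈ U) (k : Fin n) :
    dy k ρ z = 0 := by
  have hρ := differentiableAt_of_smoothOn hL.isOpen (hL.smooth_of_dy_eq hb hv hn) hz
  have key : ∀ i j k, dy k (dy j (b i)) z = dy k ρ z * hess L i j z + ρ z * dy k (hess L i j) z := by
    intro i j k
    rw [dy_eq_dir k (dy j (b i)), dir_congr hL.isOpen (fun w hw => hv w hw i j) hz,
      dir_mul hρ (hL.differentiableAt_hess hz i j)]
    rfl
  refine hL.eq_zero_of_hess hn hn' hz (r := fun k => dy k ρ z) (fun i j k => ?_) k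
  have h1 : dy k (dy j (b i)) z = dy j (dy k (b i)) z := dir_comm hL.isOpen (hb i) hz _ _
  have h2 : dy k (hess L i j) z = dy j (hess L i k) z := by
    rw [dy_eq_dir k, dir_congr hL.isOpen (fun w hw => hL.hess_symm hw i j) hz, dy_eq_dir j,
      dir_congr hL.isOpen (fun w hw => hL.hess_symm hw i k) hz]
    exact dir_comm hL.isOpen (hL.smooth.dy hL.isOpen i) hz _ _
  rw [key, key, h2] at h1
  exact add_right_cancel h1

/-- The scalar of a parallel h-vector is constant. -/
theorem dx_eq_zero_of_parallel (hn : n ≠ 1) (hρ : ∀ z ∈ U, ∀ k, dy k ρ z = 0)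
    (hpar : ∀ z ∈ U, ∀ i j, hCov L b i j z = 0) (hz : z ∈ U) (k : Fin n) : dx k ρ z = 0 := by
  have hU := hL.isOpen
  have hρs := hL.smooth_of_dy_eq hb hv hn
  -- This part of b_i depends on x only, since ∂̇_k b_i = ρ ∂̇_k l_i and ∂̇_k ρ = 0.
  set a : Fin n → E n × E n → ℝ := fun i w => b i w - ρ w * dy i L w with ha
  have has : ∀ i, ContDiffOn ℝ ∞ (a i) U := fun i =>
    (hb i).sub (hρs.mul (hL.smooth.dy hU i))
  have hdira : ∀ w ∈ U, ∀ i v, dir v (a i) w =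
      dir v (b i) w - (dir v ρ w * dy i L w + ρ w * dir v (dy i L) w) := by
    intro w hw i v
    have h1 := differentiableAt_of_smoothOn hU (hb i) hw
    have h2 := differentiableAt_of_smoothOn hU hρs hw
    have h3 := hL.differentiableAt_dy hw i
    rw [← dir_mul h2 h3, ← dir_sub h1 (h2.fun_mul h3)]
  have hdya : ∀ w ∈ U, ∀ i k, dy k (a i) w = 0 := by
    intro w hw i k
    rw [dy_eq_dir, hdira w hw, ← dy_eq_dir, ← dy_eq_dir, ← dy_eq_dir, hv w hw, hρ w hw,
      hL.hess_symm hw, hess]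
    ring
  have hdel : ∀ {f : E n × E n → ℝ} {w}, (∀ k, dy k f w = 0) → ∀ j, dx j f w = delta L j f w := by
    intro f w h j
    simp [delta, h]
  -- Both b_i and l_i are parallel and F is symmetric, so skew-symmetrising removes the connection
  -- terms.
  have hskew : ∀ w ∈ U, ∀ i j, dx j (a i) w - dx i (a j) w =
      dx i ρ w * dy j L w - dx j ρ w * dy i L w := by
    intro w hw i j
    have h1 : ∀ i j, dx j (a i) w = ∑ r, b r w * cartanF L r i j w
        - (dx j ρ w * dy i L w + ρ w * ∑ r, dy r L w * cartanF L r i j w) := by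
      intro i j
      rw [hdel (hdya w hw i), delta_eq_dir, hdira w hw, ← delta_eq_dir, ← delta_eq_dir,
        ← delta_eq_dir, hL.delta_dy hw, hdel (hρ w hw), sub_eq_zero.1 (hpar w hw i j)]
    rw [h1, h1]
    simp only [hL.cartanF_symm hw _ j i]
    ring
  have hdxs : ∀ j, ContDiffOn ℝ ∞ (dx j ρ) U := fun j => hρs.dir hU _
  have hdyx : ∀ {f : E n × E n → ℝ}, ContDiffOn ℝ ∞ f U → (∀ w ∈ U, ∀ k, dy k f w = 0) →
      ∀ w ∈ U, ∀ j k, dir (0, basisVec k) (dx j f) w = 0 := by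
    intro f hf h w hw j k
    rw [dx_eq_dir, dir_comm hU hf hw, ← dy_eq_dir, dir_congr hU (fun w hw => h w hw k) hw,
      dir_const]
  -- Differentiate `hskew` along y^i: its left side depends on x only.
  have hrank : ∀ w ∈ U, ∀ i j k, dx k ρ w * hess L i j w = dx j ρ w * hess L i k w := by
    intro w hw i j k
    have h := dir_congr hU (fun w hw => hskew w hw k j) hw (0, basisVec i)
    have hd : ∀ {f : E n × E n → ℝ}, ContDiffOn ℝ ∞ f U → DifferentiableAt ℝ f w :=
      fun hf => differentiableAt_of_smoothOn hU hf hw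
    have hd1 := hd (hdxs k)
    have hd2 := hd (hdxs j)
    have hd3 := hL.differentiableAt_dy hw k
    have hd4 := hL.differentiableAt_dy hw j
    rw [dir_sub (f := dx j (a k)) (g := dx k (a j)) (hd ((has k).dir hU _)) (hd ((has j).dir hU _)),
      dir_sub (hd1.fun_mul hd4) (hd2.fun_mul hd3), dir_mul hd1 hd4, dir_mul hd2 hd3,
      hdyx (has k) (fun w hw => hdya w hw k) w hw, hdyx (has j) (fun w hw => hdya w hw j) w hw,
      hdyx hρs hρ w hw, hdyx hρs hρ w hw] at h
    simp only [hess, dy_eq_dir] at h ⊢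
    linarith
  -- As ∂_k ρ depends on x only, a vertical derivative of this relation isolates it; this works for
  -- n = 2 as well.
  have h0 : ∀ w ∈ U, ∑ k, dx k ρ w * w.2 k = 0 := fun w hw =>
    hL.sum_mul_snd_eq_zero_of_hess hn hw (r := fun k => dx k ρ w) (hrank w hw)
  have h := dir_congr hU h0 hz (0, basisVec k)
  rw [dir_sum_mul_snd (fun j => differentiableAt_of_smoothOn hU (hdxs j) hz), dir_const] at h
  simpa [hdyx hρs hρ z hz] using h

/-- The vertical derivative of a parallel h-vector is parallel. -/
theorem delta_dy_of_parallel (hρ : n ≠ 1 → ∀ z ∈ U, ∀ k, dy k ρ z = 0)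
    (hpar : ∀ z ∈ U, ∀ i j, hCov L b i j z = 0) (hz : z ∈ U) (i j k : Fin n) :
    delta L k (dy i (b j)) z = ∑ r, dy r (b j) z * cartanF L r i k z
      + ∑ r, dy i (b r) z * cartanF L r j k z := by
  rw [delta_eq_dir, dir_congr hL.isOpen (fun w hw => hv w hw j i) hz]
  simp only [hv z hz]
  rcases eq_or_ne n 1 with hn | hn
  · rw [dir_congr hL.isOpen (g := fun _ => 0) (fun w hw => by
      rw [hL.hess_eq_zero hn hw, mul_zero]) hz, dir_const]
    simp [hL.hess_eq_zero hn hz]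
  · have hd := differentiableAt_of_smoothOn hL.isOpen (hL.smooth_of_dy_eq hb hv hn) hz
    have h0 : delta L k ρ z = 0 := by
      simp [delta, hρ hn z hz, hL.dx_eq_zero_of_parallel hb hv hn (hρ hn) hpar hz]
    rw [dir_mul hd (hL.differentiableAt_hess hz j i), ← delta_eq_dir, ← delta_eq_dir, h0,
      hL.delta_hess hz]
    simp only [mul_assoc, ← Finset.mul_sum]
    ring

end HVector

end IsFinslerOn

/-! ### The Kropina identity and its derivatives -/

/-- Coordinate form of a Kropina change `P = L² / (b_i y^i)` by an h-vector `b`. -/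
structure IsKropinaOn (U : Set (E n × E n)) (L P : E n × E n → ℝ) (b : Fin n → E n × E n → ℝ) :
    Prop where
  left : IsFinslerOn U L
  right : IsFinslerOn U P
  smooth : ∀ i, ContDiffOn ℝ ∞ (b i) U
  dy_sum : ∀ z ∈ U, ∀ k, dy k (fun w => ∑ i, b i w * w.2 i) z = b k z
  mul_sum : ∀ z ∈ U, P z * ∑ i, b i z * z.2 i = L z * L z

namespace IsKropinaOn

variable {b : Fin n → E n × E n → ℝ} (h : IsKropinaOn U L P b)

include h

theorem sum_ne_zero (hz : z ∈ U) : ∑ i, b i z * z.2 i ≠ 0 := by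
  intro h0
  have := h.mul_sum z hz
  rw [h0, mul_zero] at this
  have := h.left.pos z hz
  nlinarith

theorem differentiableAt_covec (hz : z ∈ U) (i : Fin n) : DifferentiableAt ℝ (b i) z :=
  differentiableAt_of_smoothOn h.left.isOpen (h.smooth i) hz

theorem differentiableAt_sum (hz : z ∈ U) :
    DifferentiableAt ℝ (fun w => ∑ i, b i w * w.2 i) z :=
  DifferentiableAt.fun_sum fun i _ =>
    (h.differentiableAt_covec hz i).fun_mul (hasFDerivAt_snd_apply i).differentiableAt

/-- Start of a chain: a vertical v yields the next identity to differentiate, a horizontal v yields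
the action of δ_k. -/
theorem dir_mul_sum (hz : z ∈ U) (v : E n × E n) :
    dir v P z * (∑ i, b i z * z.2 i) + P z * dir v (fun w => ∑ i, b i w * w.2 i) z =
      2 * (L z * dir v L z) := by
  have hd := h.left.differentiableAt hz
  have h1 := dir_congr h.left.isOpen h.mul_sum hz v
  rw [dir_mul (h.right.differentiableAt hz) (h.differentiableAt_sum hz), dir_mul hd hd] at h1
  linarith

theorem dy_mul_sum (hz : z ∈ U) (j : Fin n) :
    dy j P z * (∑ i, b i z * z.2 i) + P z * b j z = 2 * (L z * dy j L z) := by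
  have := h.dir_mul_sum hz (0, basisVec j)
  simpa only [← dy_eq_dir, h.dy_sum z hz] using this

theorem dir_dy_mul_sum (hz : z ∈ U) (j : Fin n) (v : E n × E n) :
    dir v (dy j P) z * (∑ i, b i z * z.2 i) + dy j P z * dir v (fun w => ∑ i, b i w * w.2 i) z
      + (dir v P z * b j z + P z * dir v (b j) z) =
      2 * (dir v L z * dy j L z + L z * dir v (dy j L) z) := by
  have hd := h.left.differentiableAt hz
  have hs := h.differentiableAt_sum hz
  have hP := h.right.differentiableAt hz
  have hPj := h.right.differentiableAt_dy hz j
  have hLj := h.left.differentiableAt_dy hz j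
  have hb := h.differentiableAt_covec hz j
  have h1 := dir_congr h.left.isOpen (fun w hw => h.dy_mul_sum hw j) hz v
  rwa [dir_add (hPj.fun_mul hs) (hP.fun_mul hb), dir_mul hPj hs, dir_mul hP hb,
    dir_const_mul (f := fun w => L w * dy j L w) (hd.fun_mul hLj), dir_mul hd hLj] at h1

theorem hess_mul_sum (hz : z ∈ U) (i j : Fin n) :
    hess P i j z * (∑ i, b i z * z.2 i) + dy j P z * b i z
      + (dy i P z * b j z + P z * dy i (b j) z) =
      2 * (dy i L z * dy j L z + L z * hess L i j z) := by
  have := h.dir_dy_mul_sum hz j (0, basisVec i)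
  simpa only [← dy_eq_dir, h.dy_sum z hz, hess] using this

theorem dir_hess_mul_sum (hz : z ∈ U) (i j : Fin n) (v : E n × E n) :
    dir v (hess P i j) z * (∑ i, b i z * z.2 i)
      + hess P i j z * dir v (fun w => ∑ i, b i w * w.2 i) z
      + (dir v (dy j P) z * b i z + dy j P z * dir v (b i) z)
      + ((dir v (dy i P) z * b j z + dy i P z * dir v (b j) z)
        + (dir v P z * dy i (b j) z + P z * dir v (dy i (b j)) z)) =
      2 * ((dir v (dy i L) z * dy j L z + dy i L z * dir v (dy j L) z)
        + (dir v L z * hess L i j z + L z * dir v (hess L i j) z)) := by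
  have hd := h.left.differentiableAt hz
  have hs := h.differentiableAt_sum hz
  have hP := h.right.differentiableAt hz
  have hPy := h.right.differentiableAt_dy hz
  have hLy := h.left.differentiableAt_dy hz
  have hPh := h.right.differentiableAt_hess hz i j
  have hLh := h.left.differentiableAt_hess hz i j
  have hb := h.differentiableAt_covec hz
  have hbi := differentiableAt_of_smoothOn h.left.isOpen ((h.smooth j).dy h.left.isOpen i) hz
  have h1 := dir_congr h.left.isOpen (fun w hw => h.hess_mul_sum hw i j) hz v
  rwa [dir_add ((hPh.fun_mul hs).fun_add ((hPy j).fun_mul (hb i)))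
      (((hPy i).fun_mul (hb j)).fun_add (hP.fun_mul hbi)),
    dir_add (hPh.fun_mul hs) ((hPy j).fun_mul (hb i)),
    dir_add ((hPy i).fun_mul (hb j)) (hP.fun_mul hbi),
    dir_mul hPh hs, dir_mul (hPy j) (hb i), dir_mul (hPy i) (hb j), dir_mul hP hbi,
    dir_const_mul (f := fun w => dy i L w * dy j L w + L w * hess L i j w)
      (((hLy i).fun_mul (hLy j)).fun_add (hd.fun_mul hLh)),
    dir_add ((hLy i).fun_mul (hLy j)) (hd.fun_mul hLh), dir_mul (hLy i) (hLy j), dir_mul hd hLh] at h1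

/-- Used with a^r = F^r_ik, to supply the connection terms subtracted from a horizontal derivative.
-/
theorem sum_dy_mul (hz : z ∈ U) (a : Fin n → ℝ) :
    (∑ r, dy r P z * a r) * (∑ i, b i z * z.2 i) + P z * ∑ r, b r z * a r =
      2 * (L z * ∑ r, dy r L z * a r) := by
  have h1 := h.dy_mul_sum hz
  -- Making β an atom keeps `simp` from distributing products over its sum.
  generalize ∑ i, b i z * z.2 i = s at h1 ⊢
  simp only [Finset.sum_mul, Finset.mul_sum, ← Finset.sum_add_distrib]
  refine Finset.sum_congr rfl fun r _ => ?_
  linear_combination a r * h1 r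

theorem sum_hess_mul_left (hz : z ∈ U) (j : Fin n) (a : Fin n → ℝ) :
    (∑ r, hess P r j z * a r) * (∑ i, b i z * z.2 i) + dy j P z * ∑ r, b r z * a r
      + ((∑ r, dy r P z * a r) * b j z + P z * ∑ r, dy r (b j) z * a r) =
      2 * ((∑ r, dy r L z * a r) * dy j L z + L z * ∑ r, hess L r j z * a r) := by
  have h1 := fun r => h.hess_mul_sum hz r j
  generalize ∑ i, b i z * z.2 i = s at h1 ⊢
  simp only [Finset.sum_mul, Finset.mul_sum, ← Finset.sum_add_distrib]
  refine Finset.sum_congr rfl fun r _ => ?_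
  linear_combination a r * h1 r

theorem sum_hess_mul_right (hz : z ∈ U) (i : Fin n) (a : Fin n → ℝ) :
    (∑ r, hess P i r z * a r) * (∑ i, b i z * z.2 i) + (∑ r, dy r P z * a r) * b i z
      + (dy i P z * ∑ r, b r z * a r + P z * ∑ r, dy i (b r) z * a r) =
      2 * (dy i L z * ∑ r, dy r L z * a r + L z * ∑ r, hess L i r z * a r) := by
  have h1 := fun r => h.hess_mul_sum hz i r
  generalize ∑ i, b i z * z.2 i = s at h1 ⊢
  simp only [Finset.sum_mul, Finset.mul_sum, ← Finset.sum_add_distrib]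
  refine Finset.sum_congr rfl fun r _ => ?_
  linear_combination a r * h1 r

theorem parallel_of_cartanF_eq (hz : z ∈ U)
    (hF : ∀ i j k, cartanF L i j k z = cartanF P i j k z) (i k : Fin n) :
    hCov L b i k z = 0 := by
  have hN : ∀ i j, nonlin L i j z = nonlin P i j z := fun i j => by
    rw [← h.left.sum_cartanF_mul_snd hz, ← h.right.sum_cartanF_mul_snd hz]
    simp only [hF]
  -- Agreement at the single point z suffices: δ_k at z is a derivative along one fixed vector.
  have hδ : ∀ f, dir (horiz L k z) f z = delta P k f z := fun f => by
    rw [← delta_eq_dir, delta, delta]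
    simp only [hN]
  have hP0 : P z ≠ 0 := (h.right.pos z hz).ne'
  have h1 := h.dir_mul_sum hz (horiz L k z)
  rw [hδ P, h.right.delta_self hz, ← delta_eq_dir L k L, h.left.delta_self hz] at h1
  have h2 : dir (horiz L k z) (fun w => ∑ i, b i w * w.2 i) z = 0 := by
    have : P z * dir (horiz L k z) (fun w => ∑ i, b i w * w.2 i) z = 0 := by linarith
    exact (mul_eq_zero.1 this).resolve_left hP0
  have h3 := h.dir_dy_mul_sum hz i (horiz L k z)
  rw [h2, hδ P, h.right.delta_self hz, hδ (dy i P), h.right.delta_dy hz, ← delta_eq_dir,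
    ← delta_eq_dir, ← delta_eq_dir, h.left.delta_self hz, h.left.delta_dy hz] at h3
  simp only [← hF] at h3
  have h4 := h.sum_dy_mul hz fun r => cartanF L r i k z
  refine (mul_eq_zero.1 (?_ : P z * hCov L b i k z = 0)).resolve_left hP0
  rw [hCov]
  linarith

theorem cartanF_eq_of_parallel
    (hpar : ∀ z ∈ U, ∀ i j, hCov L b i j z = 0)
    (hdy : ∀ z ∈ U, ∀ i j k, delta L k (dy i (b j)) z = ∑ r, dy r (b j) z * cartanF L r i k z
      + ∑ r, dy i (b r) z * cartanF L r j k z) (hz : z ∈ U) (i j k : Fin n) :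
    cartanF L i j k z = cartanF P i j k z := by
  have hβ := h.sum_ne_zero hz
  have hδβ : ∀ k, dir (horiz L k z) (fun w => ∑ i, b i w * w.2 i) z = 0 := by
    intro k
    rw [← delta_eq_dir, h.left.delta_sum_mul_snd hz (h.differentiableAt_covec hz)]
    simp [hpar z hz]
  have hδb : ∀ i k, delta L k (b i) z = ∑ r, b r z * cartanF L r i k z := fun i k =>
    sub_eq_zero.1 (hpar z hz i k)
  have hδP : ∀ k, delta L k P z = 0 := by
    intro k
    have := h.dir_mul_sum hz (horiz L k z)
    rw [hδβ, ← delta_eq_dir, ← delta_eq_dir, h.left.delta_self hz] at this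
    exact (mul_eq_zero.1 (by linarith : delta L k P z * _ = 0)).resolve_right hβ
  have hδPy : ∀ i k, delta L k (dy i P) z = ∑ r, dy r P z * cartanF L r i k z := by
    intro i k
    have h1 := h.dir_dy_mul_sum hz i (horiz L k z)
    rw [hδβ] at h1
    simp only [← delta_eq_dir, h.left.delta_self hz, hδP, hδb, h.left.delta_dy hz] at h1
    refine mul_right_cancel₀ hβ ?_
    linear_combination h1 - h.sum_dy_mul hz fun r => cartanF L r i k z
  have hδPh : ∀ i j k, delta L k (hess P i j) z =
      ∑ r, hess P r j z * cartanF L r i k z + ∑ r, hess P i r z * cartanF L r j k z := by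
    intro i j k
    have h1 := h.dir_hess_mul_sum hz i j (horiz L k z)
    rw [hδβ] at h1
    simp only [← delta_eq_dir, h.left.delta_self hz, hδP, hδb, h.left.delta_dy hz, hδPy,
      hdy z hz, h.left.delta_hess hz] at h1
    refine mul_right_cancel₀ hβ ?_
    linear_combination h1 - h.sum_hess_mul_left hz j (fun r => cartanF L r i k z)
      - h.sum_hess_mul_right hz i (fun r => cartanF L r j k z)
  have hmet : ∀ i j k, delta L k (metric P i j) z =
      ∑ r, metric P j r z * cartanF L r i k z + ∑ r, metric P i r z * cartanF L r j k z := by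
    intro i j k
    have hP := h.right.differentiableAt hz
    have hPy := h.right.differentiableAt_dy hz
    have hPh := h.right.differentiableAt_hess hz i j
    rw [delta_eq_dir, dir_congr h.right.isOpen (fun w hw => h.right.metric_eq hw i j) hz,
      dir_add ((hPy i).fun_mul (hPy j)) (hP.fun_mul hPh), dir_mul (hPy i) (hPy j), dir_mul hP hPh]
    simp only [← delta_eq_dir, hδP, hδPy, hδPh, h.right.metric_eq hz, add_mul,
      Finset.sum_add_distrib, mul_assoc, ← Finset.mul_sum, h.right.hess_symm hz j]
    ring
  exact ((h.right.cartan_unique hz (h.left.cartanF_symm hz)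
    (h.left.sum_cartanF_mul_snd hz) hmet).2 i j k).symm

end IsKropinaOn

end LocalKropina

/-! ### Passage from the manifold to charts -/

section Coordinates

variable {n : ℕ} {M : Type*} [TopologicalSpace M] [ChartedSpace (E n) M]
  {φ : OpenPartialHomeomorph M (E n)} {D : Set (TangentBundle (𝓡 n) M)}

theorem frame_smul (φ : OpenPartialHomeomorph M (E n)) (x : E n) (t : ℝ) (y : E n) :
    frame φ x (t • y) = t • frame φ x y :=
  (mfderiv (𝓡 n) (𝓡 n) φ.symm x).map_smul t y

theorem sum_coordCovec_mul_snd (φ : OpenPartialHomeomorph M (E n))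
    (b : (u : TangentBundle (𝓡 n) M) → TangentSpace (𝓡 n) u.proj →L[ℝ] ℝ) (z : E n × E n) :
    ∑ i, coordCovec φ b i z * z.2 i = b (ofCoord φ z) (frame φ z.1 z.2) := by
  let ℓ : E n →L[ℝ] ℝ := (b (ofCoord φ z)).comp (mfderiv (𝓡 n) (𝓡 n) φ.symm z.1)
  have h : ℓ z.2 = ∑ i, z.2 i • ℓ (basisVec i) := by
    conv_lhs => rw [← sum_smul_basisVec z.2]
    simp only [map_sum, map_smul]
  calc ∑ i, coordCovec φ b i z * z.2 i = ∑ i, z.2 i • ℓ (basisVec i) :=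
        Finset.sum_congr rfl fun i _ => mul_comm _ _
    _ = _ := h.symm

variable [IsManifold (𝓡 n) ∞ M]

/-- Over the chart target, `ofCoord` is the tangent map of `φ.symm`, hence continuous. -/
theorem isOpen_coordDomain (hφ : φ ∈ IsManifold.maximalAtlas (𝓡 n) ∞ M) (hD : IsOpen D) :
    IsOpen (coordDomain φ D) := by
  have hs : ContMDiffOn (𝓡 n) (𝓡 n) ∞ φ.symm φ.target := contMDiffOn_symm_of_mem_maximalAtlas hφ
  have hc := hs.continuousOn_tangentMapWithin (by simp) φ.open_target.uniqueMDiffOn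
  have hc' : ContinuousOn (ofCoord φ) (Prod.fst ⁻¹' φ.target) := by
    have h1 : Continuous (tangentBundleModelSpaceHomeomorph (𝓡 n)).symm :=
      (tangentBundleModelSpaceHomeomorph (𝓡 n)).symm.continuous
    refine (hc.comp h1.continuousOn (s := Prod.fst ⁻¹' φ.target) fun z hz => hz).congr ?_
    intro z hz
    refine (tangentMapWithin_eq_tangentMap (f := φ.symm) (s := φ.target)
      (p := (tangentBundleModelSpaceHomeomorph (𝓡 n)).symm z)
      (φ.open_target.uniqueMDiffWithinAt hz) ?_).symm
    exact (hs.contMDiffAt (φ.open_target.mem_nhds hz)).mdifferentiableAt (by simp)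
  exact hc'.isOpen_inter_preimage (φ.open_target.preimage continuous_fst) hD

theorem IsFinslerSpace.isFinslerOn {L : TangentBundle (𝓡 n) M → ℝ} (hL : IsFinslerSpace D L)
    (hφ : φ ∈ IsManifold.maximalAtlas (𝓡 n) ∞ M) :
    IsFinslerOn (coordDomain φ D) (coordFun φ L) where
  isOpen := isOpen_coordDomain hφ hL.isOpen
  pos z hz := hL.pos _ hz.2
  smooth := hL.smooth φ hφ
  homogeneous z hz t ht := by
    have := hL.homogeneous _ hz.2 t ht
    refine Eq.trans ?_ this
    simp only [coordFun, ofCoord, frame_smul]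
    rfl
  nonsingular := hL.nonsingular φ hφ

theorem IsHVector.dy_eq {L : TangentBundle (𝓡 n) M → ℝ} {ρ : TangentBundle (𝓡 n) M → ℝ}
    {b : (u : TangentBundle (𝓡 n) M) → TangentSpace (𝓡 n) u.proj →L[ℝ] ℝ}
    (hL : IsFinslerSpace D L) (hb : IsHVector D L b ρ)
    (hφ : φ ∈ IsManifold.maximalAtlas (𝓡 n) ∞ M) {z : E n × E n} (hz : z ∈ coordDomain φ D)
    (i k : Fin n) : dy k (coordCovec φ b i) z = coordFun φ ρ z * hess (coordFun φ L) i k z := by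
  have hF := hL.isFinslerOn hφ
  have h1 := hb.vCov_eq_zero φ hφ z hz i k
  have h2 := hb.cartan_eq φ hφ z hz i k
  rw [hF.angular_eq hz] at h2
  simp only [vCov, mul_comm (coordCovec φ b _ z)] at h1
  refine mul_left_cancel₀ (hF.pos z hz).ne' ?_
  rw [sub_eq_zero.1 h1, h2]
  ring

theorem IsHVector.isKropinaOn {L : TangentBundle (𝓡 n) M → ℝ} {ρ : TangentBundle (𝓡 n) M → ℝ}
    {b : (u : TangentBundle (𝓡 n) M) → TangentSpace (𝓡 n) u.proj →L[ℝ] ℝ}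
    (hb : IsHVector D L b ρ) (hL : IsFinslerSpace D L) (hK : IsFinslerSpace D (kropina L b))
    (hφ : φ ∈ IsManifold.maximalAtlas (𝓡 n) ∞ M) :
    IsKropinaOn (coordDomain φ D) (coordFun φ L) (coordFun φ (kropina L b)) (coordCovec φ b) where
  left := hL.isFinslerOn hφ
  right := hK.isFinslerOn hφ
  smooth := hb.smooth φ hφ
  dy_sum z hz k := by
    have hF := hL.isFinslerOn hφ
    rw [dy_eq_dir, dir_sum_mul_snd
      (fun i => differentiableAt_of_smoothOn hF.isOpen (hb.smooth φ hφ i) hz)]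
    simp only [← dy_eq_dir, hb.dy_eq hL hφ hz, mul_assoc, ← Finset.mul_sum,
      hF.sum_hess_mul_snd' hz]
    simp
  mul_sum z hz := by
    have h0 := hK.pos _ hz.2
    have hk : coordFun φ (kropina L b) z =
      coordFun φ L z ^ 2 / ∑ i, coordCovec φ b i z * z.2 i := by
      rw [sum_coordCovec_mul_snd]
      rfl
    change 0 < coordFun φ (kropina L b) z at h0
    rw [hk] at h0 ⊢
    -- β ≠ 0 because division by zero would make *L equal to 0, against its positivity.
    rw [div_mul_cancel₀ _ fun h => by simp [h] at h0, pow_two]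

theorem IsHVector.dy_eq_zero {L : TangentBundle (𝓡 n) M → ℝ} {ρ : TangentBundle (𝓡 n) M → ℝ}
    {b : (u : TangentBundle (𝓡 n) M) → TangentSpace (𝓡 n) u.proj →L[ℝ] ℝ}
    (hb : IsHVector D L b ρ) (hL : IsFinslerSpace D L)
    (hρ : n = 2 → ∀ u ∈ D, ∀ v ∈ D, u.proj = v.proj → ρ u = ρ v)
    (hφ : φ ∈ IsManifold.maximalAtlas (𝓡 n) ∞ M) (hn : n ≠ 1) {z : E n × E n}
    (hz : z ∈ coordDomain φ D) (k : Fin n) : dy k (coordFun φ ρ) z = 0 := by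
  have hF := hL.isFinslerOn hφ
  have hv := fun z hz i k => hb.dy_eq hL hφ (z := z) hz i k
  by_cases hn2 : n = 2
  · have hd := differentiableAt_of_smoothOn hF.isOpen
      (hF.smooth_of_dy_eq (hb.smooth φ hφ) hv hn) hz
    have hg : Filter.Tendsto (fun t : ℝ => z + t • ((0, basisVec k) : E n × E n)) (nhds 0)
        (nhds z) := by
      have : Continuous (fun t : ℝ => z + t • ((0, basisVec k) : E n × E n)) := by fun_prop
      simpa using this.tendsto 0
    -- The vertical line through z stays over one base point, where ρ is constant on D.
    have h1 : HasLineDerivAt ℝ (coordFun φ ρ) (dy k (coordFun φ ρ) z) z (0, basisVec k) :=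
      hd.hasFDerivAt.hasLineDerivAt _
    refine HasDerivAt.unique h1
      ((hasDerivAt_const (0 : ℝ) (coordFun φ ρ z)).congr_of_eventuallyEq ?_)
    filter_upwards [hg (hF.isOpen.mem_nhds hz)] with t ht
    refine hρ hn2 _ ht.2 _ hz.2 ?_
    simp [ofCoord]
  · exact hF.dy_eq_zero_of_dy_eq (hb.smooth φ hφ) hv hn hn2 hz k

end Coordinates

end Finsler

end

theorem theorem3p1 {n : ℕ} {M : Type*} [TopologicalSpace M] [ChartedSpace (Finsler.E n) M]
    [IsManifold (𝓡 n) ∞ M]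
    (D : Set (TangentBundle (𝓡 n) M)) (L : TangentBundle (𝓡 n) M → ℝ)
    (b : (u : TangentBundle (𝓡 n) M) → TangentSpace (𝓡 n) u.proj →L[ℝ] ℝ)
    (ρ : TangentBundle (𝓡 n) M → ℝ)
    (hL : Finsler.IsFinslerSpace D L)
    (hb : Finsler.IsHVector D L b ρ)
    (hρ : n = 2 → ∀ u ∈ D, ∀ v ∈ D, u.proj = v.proj → ρ u = ρ v)
    (hK : Finsler.IsFinslerSpace D (Finsler.kropina L b)) :
    Finsler.SameCartanCoefficients D L (Finsler.kropina L b) ↔ Finsler.IsParallel D L b := by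
  -- The equivalence holds in each chart separately.
  refine forall₂_congr fun φ hφ => ?_
  have h := hb.isKropinaOn hL hK hφ
  refine ⟨fun hF z hz i k => h.parallel_of_cartanF_eq hz (hF z hz) i k, fun hpar z hz i j k => ?_⟩
  refine h.cartanF_eq_of_parallel hpar (fun z hz i j k => ?_) hz i j k
  exact h.left.delta_dy_of_parallel h.smooth (fun z hz i k => hb.dy_eq hL hφ hz i k)
    (fun hn z hz k => hb.dy_eq_zero hL hρ hφ hn hz k) hpar hz i j k
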